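/- Let $0\le m\le n$ be integers, let $G(n,m)$ be the Grassmannian of $m$-dimensional linear subspaces of $\mathbb R^n$ with its $O(n)$-invariant Borel probability measure $\gamma_{n,m}$, and for $V\in G(n,m)$ let $P_V:\mathbb R^n\to V$ be the orthogonal projection. Let $\mu,\nu$ be Borel measures on $\mathbb R^n$ with compact supports $\operatorname{spt}\mu$, $\operatorname{spt}\nu$ and with $0<\mu(\mathbb R^n)<\infty$, $0<\nu(\mathbb R^n)<\infty$. For $s>0$ write $I_s(\mu)=\iint|x-y|^{-s}\,d\mu(x)\,d\mu(y)\in[0,\infty]$. (1) If $s,t>0$, $s+t=2m$, $I_s(\mu)<\infty$ and $I_t(\nu)<\infty$, then $$\gamma_{n,m}\bigl(\{V\in G(n,m): P_V(\operatorname{spt}\mu)\cap P_V(\operatorname{spt}\nu)\neq\emptyset\}\bigr)>0.$$ (2) If $s>2m$, $t>2m$, $I_s(\mu)<\infty$ and $I_t(\nu)<\infty$, then $$\gamma_{n,m}\bigl(\{V\in G(n,m): \operatorname{Int}\bigl(P_V(\operatorname{spt}\mu)\cap P_V(\operatorname{spt}\nu)\bigr)\neq\emptyset\}\bigr)>0,$$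 where $\operatorname{Int}$ denotes the interior relative to $V$. -/

import Mathlib

open MeasureTheory

noncomputable section

namespace ProjIntersect

/-- The Euclidean space `ℝⁿ`. -/
abbrev Eucl (n : ℕ) : Type := EuclideanSpace ℝ (Fin n)

/-- The class `𝓜(A)`: Borel measures `μ` on `ℝⁿ` with `0 < μ(A) < ∞` and with compact support
contained in `A`. -/
structure IsAdmissible {n : ℕ} (A : Set (Eucl n)) (μ : Measure (Eucl n)) : Prop where
  pos : 0 < μ A
  lt_top : μ A < ⊤
  isCompact_support : IsCompact μ.support
  support_subset : μ.support ⊆ A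

/-- The `s`-energy `I_s(μ) = ∬ |x - y|^{-s} dμ(x) dμ(y)`, with values in `[0, ∞]`
(for `s > 0` the integrand is `∞` on the diagonal). -/
def energy {n : ℕ} (s : ℝ) (μ : Measure (Eucl n)) : ENNReal :=
  ∫⁻ y, ∫⁻ x, ‖x - y‖ₑ ^ (-s) ∂μ ∂μ

/-- The Grassmannian `G(n,m)` of `m`-dimensional linear subspaces of `ℝⁿ`. -/
def Grassmannian (n m : ℕ) : Type :=
  {V : Submodule ℝ (Eucl n) // Module.finrank ℝ V = m}

/-- The topology of `G(n,m)` is that of the metric `d(V, W) = ‖P_V - P_W‖` (operator norm). -/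
instance (n m : ℕ) : TopologicalSpace (Grassmannian n m) :=
  TopologicalSpace.induced (fun V => V.1.starProjection) inferInstance

instance (n m : ℕ) : MeasurableSpace (Grassmannian n m) := borel _

instance (n m : ℕ) : BorelSpace (Grassmannian n m) := ⟨rfl⟩

/-- The orthogonal group `O(n)`, with the topology of the operator norm. -/
abbrev OrthGroup (n : ℕ) : Type := unitary (Eucl n →L[ℝ] Eucl n)

instance (n : ℕ) : ContinuousStar (Eucl n →L[ℝ] Eucl n) :=
  ⟨(ContinuousLinearMap.adjoint (𝕜 := ℝ) (E := Eucl n) (F := Eucl n)).continuous⟩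

instance (n : ℕ) : CompactSpace (OrthGroup n) := by
  refine isCompact_iff_compactSpace.mp ?_
  refine Metric.isCompact_of_isClosed_isBounded isClosed_unitary ?_
  refine isBounded_iff_forall_norm_le.mpr ⟨1, fun u hu => ?_⟩
  refine ContinuousLinearMap.opNorm_le_bound _ zero_le_one fun x => ?_
  rw [one_mul]
  exact ((Unitary.linearIsometryEquiv ⟨u, hu⟩).norm_map x).le

/-- The Haar probability measure of `O(n)`. -/
def orthHaar (n : ℕ) : Measure (OrthGroup n) := Measure.haarMeasure ⊤

/-- The coordinate plane spanned by the first `m` standard basis vectors of `ℝⁿ`. -/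
def coordPlane {n m : ℕ} (h : m ≤ n) : Grassmannian n m :=
  ⟨Submodule.span ℝ (Set.range fun i : Fin m =>
      EuclideanSpace.basisFun (Fin n) ℝ (Fin.castLE h i)), by
    have hli := (EuclideanSpace.basisFun (Fin n) ℝ).orthonormal.linearIndependent.comp
      (Fin.castLE h) (Fin.castLE_injective h)
    simpa [Function.comp_def] using finrank_span_eq_card hli⟩

/-- The action `(g, V) ↦ g V` of `O(n)` on `G(n,m)`. -/
def rotate {n m : ℕ} (g : OrthGroup n) (V : Grassmannian n m) : Grassmannian n m :=
  ⟨V.1.map (Unitary.linearIsometryEquiv g).toLinearEquiv.toLinearMap, by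
    rw [LinearEquiv.finrank_map_eq]; exact V.2⟩

/-- The measure `γ_{n,m}` on `G(n,m)`: the `O(n)`-invariant Borel probability measure,
`γ_{n,m}(𝒜) = θ_n {g ∈ O(n) : g V₀ ∈ 𝒜}` with `θ_n` the Haar probability measure. -/
def grassMeasure {n m : ℕ} (h : m ≤ n) : Measure (Grassmannian n m) :=
  (orthHaar n).map fun g => rotate g (coordPlane h)

theorem continuous_rotate {n m : ℕ} (V : Grassmannian n m) :
    Continuous fun g : OrthGroup n => rotate g V := by
  refine continuous_induced_rng.mpr ?_
  have h : ((fun V : Grassmannian n m => V.1.starProjection) ∘ fun g : OrthGroup n => rotate g V) =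
      fun g : OrthGroup n => (g : Eucl n →L[ℝ] Eucl n) * V.1.starProjection *
        star (g : Eucl n →L[ℝ] Eucl n) := by
    funext g
    ext1 x
    exact Submodule.starProjection_map_apply (Unitary.linearIsometryEquiv g) V.1 x
  rw [h]
  exact (continuous_subtype_val.mul continuous_const).mul continuous_subtype_val.star

instance {n m : ℕ} (h : m ≤ n) : IsProbabilityMeasure (grassMeasure h) := by
  have : IsProbabilityMeasure (orthHaar n) := ⟨by
    simpa [orthHaar] using Measure.haarMeasure_self (G := OrthGroup n) (K₀ := ⊤)⟩
  exact Measure.isProbabilityMeasure_map (continuous_rotate _).measurable.aemeasurable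

/-- The measure `γ_{n,m}` is invariant under the action of `O(n)`. -/
theorem map_rotate_grassMeasure {n m : ℕ} (h : m ≤ n) (g : OrthGroup n) :
    (grassMeasure h).map (rotate g) = grassMeasure h := by
  have hmul : ∀ (a b : OrthGroup n) (V : Grassmannian n m),
      rotate (a * b) V = rotate a (rotate b V) := by
    intro a b V
    apply Subtype.ext
    ext x
    simp only [rotate, map_mul]
    simp
    rfl
  have hc : Continuous (rotate g : Grassmannian n m → Grassmannian n m) := by
    refine continuous_induced_rng.mpr ?_
    have h : ((fun V : Grassmannian n m => V.1.starProjection) ∘ rotate g) =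
        fun V : Grassmannian n m => (g : Eucl n →L[ℝ] Eucl n) * V.1.starProjection *
          star (g : Eucl n →L[ℝ] Eucl n) := by
      funext V
      ext1 x
      exact Submodule.starProjection_map_apply (Unitary.linearIsometryEquiv g) V.1 x
    rw [h]
    exact (continuous_const.mul continuous_induced_dom).mul continuous_const
  have : Measure.IsMulLeftInvariant (orthHaar n) := by
    unfold orthHaar; infer_instance
  unfold grassMeasure
  conv_rhs => rw [← map_mul_left_eq_self (orthHaar n) g]
  rw [Measure.map_map hc.measurable (continuous_rotate _).measurable,
    Measure.map_map (continuous_rotate _).measurable (measurable_const_mul g)]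
  congr 1
  funext a
  exact (hmul g a _).symm

/-- The orthogonal projection `P_V(A)` of a set `A ⊆ ℝⁿ`, as a subset of the space `V`. -/
def projSet {n m : ℕ} (V : Grassmannian n m) (A : Set (Eucl n)) : Set V.1 :=
  V.1.orthogonalProjectionOnto '' A

end ProjIntersect

end

/-!
Let `λ_V` be the difference measure of the projections of `μ` and `ν` to a plane `V`; its
characteristic function is the restriction of `μ̂ · conj ν̂` to `V`. If the projected supports are
disjoint, then `λ_V` vanishes near `0`, and so does `∫_V μ̂ · conj ν̂` whenever it converges
absolutely. Hence it suffices that this integral is nonzero for a set of planes of positive measure.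
Averaging Lebesgue measure over the planes `V ∈ G(n, m)` gives a multiple of the Riesz measure
`‖x‖ ^ (m - n) dx`. Writing Riesz kernels as mixtures of Gaussians, for which Fourier inversion is
explicit, shows that `∫ μ̂ · conj ν̂ · ‖x‖ ^ (m - n) dx` is positive, as a multiple of the mutual
`m`-energy, and that `I_s(μ)` is a multiple of `∫ |μ̂|² ‖x‖ ^ (s - n) dx`.

If `s + t = 2 m`, absolute convergence on almost every plane follows from AM–GM. If `s, t > 2 m`,
then `μ̂` and `ν̂` are themselves integrable on almost every plane, so the projected measures have
continuous densities; their product has integral proportional to `∫_V μ̂ · conj ν̂`, and a point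
where it is nonzero is interior to both projected supports.
-/

noncomputable section

namespace ProjIntersect

open Filter Topology Complex Module
open scoped RealInnerProductSpace ComplexConjugate ENNReal FourierTransform

section GaussianMeans

section

variable {E : Type*} [NormedAddCommGroup E] [MeasurableSpace E] [BorelSpace E]

theorem integrable_exp_neg_sq_norm_div (μ : Measure E) [IsFiniteMeasure μ] {r : ℝ} (hr : 0 < r) :
    Integrable (fun z => Real.exp (-‖z‖ ^ 2 / (4 * r))) μ := by
  refine (integrable_const (1 : ℝ)).mono' (Continuous.aestronglyMeasurable (by fun_prop))
    (.of_forall fun z => ?_)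
  rw [Real.norm_of_nonneg (Real.exp_pos _).le, Real.exp_le_one_iff, neg_div, neg_nonpos]
  positivity

theorem integral_exp_neg_sq_norm_div_pos {μ : Measure E} [IsFiniteMeasure μ] (hμ : μ ≠ 0) {r : ℝ}
    (hr : 0 < r) : 0 < ∫ z, Real.exp (-‖z‖ ^ 2 / (4 * r)) ∂μ := by
  have hμ' : NeZero μ := ⟨hμ⟩
  exact integral_exp_pos (integrable_exp_neg_sq_norm_div μ hr)

theorem integral_exp_neg_sq_norm_div_le {μ : Measure E} [IsFiniteMeasure μ] {ρ : ℝ} (hρ : 0 ≤ ρ)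
    (h0 : μ (Metric.ball 0 ρ) = 0) {r : ℝ} (hr : 0 < r) :
    ∫ z, Real.exp (-‖z‖ ^ 2 / (4 * r)) ∂μ ≤ μ.real Set.univ * Real.exp (-ρ ^ 2 / (4 * r)) := by
  have hle : ∀ᵐ z ∂μ, Real.exp (-‖z‖ ^ 2 / (4 * r)) ≤ Real.exp (-ρ ^ 2 / (4 * r)) := by
    filter_upwards [measure_eq_zero_iff_ae_notMem.mp h0] with z hz
    have hz : ρ ≤ ‖z‖ := by simpa using hz
    gcongr
  calc _ ≤ ∫ z, Real.exp (-ρ ^ 2 / (4 * r)) ∂μ :=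
        integral_mono_ae (integrable_exp_neg_sq_norm_div μ hr) (integrable_const _) hle
    _ = _ := by rw [integral_const, smul_eq_mul]

end

variable {E : Type*} [NormedAddCommGroup E] [InnerProductSpace ℝ E] [FiniteDimensional ℝ E]
  [MeasurableSpace E] [BorelSpace E]

theorem integrable_exp_neg_mul_sq_norm {r : ℝ} (hr : 0 < r) :
    Integrable fun x : E => Real.exp (-r * ‖x‖ ^ 2) := by
  refine .of_integral_ne_zero ?_
  rw [GaussianFourier.integral_rexp_neg_mul_sq_norm hr]
  positivity

theorem integral_exp_inner_mul_gaussian {r : ℝ} (hr : 0 < r) (z : E) :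
    ∫ x, cexp (⟪z, x⟫ * I) * (Real.exp (-r * ‖x‖ ^ 2) : ℂ) =
      ((Real.pi / r) ^ (finrank ℝ E / 2 : ℝ) * Real.exp (-‖z‖ ^ 2 / (4 * r)) : ℝ) := by
  have h := GaussianFourier.integral_cexp_neg_mul_sq_norm_add (b := r) (by simpa using hr) I z
  calc ∫ x, cexp (⟪z, x⟫ * I) * (Real.exp (-r * ‖x‖ ^ 2) : ℂ)
      = ∫ x : E, cexp (-(r : ℂ) * ‖x‖ ^ 2 + I * ⟪z, x⟫) := by
        congr 1 with x
        push_cast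
        rw [← Complex.exp_add]
        ring_nf
    _ = _ := by
        rw [h, ofReal_mul, ofReal_cpow (by positivity)]
        push_cast
        simp

theorem integral_charFun_mul_gaussian (μ : Measure E) [IsFiniteMeasure μ] {r : ℝ} (hr : 0 < r) :
    ∫ x, charFun μ x * (Real.exp (-r * ‖x‖ ^ 2) : ℂ) =
      ((Real.pi / r) ^ (finrank ℝ E / 2 : ℝ) * ∫ z, Real.exp (-‖z‖ ^ 2 / (4 * r)) ∂μ : ℝ) := by
  have hint : Integrable (fun p : E × E =>
      cexp (⟪p.2, p.1⟫ * I) * (Real.exp (-r * ‖p.1‖ ^ 2) : ℂ)) (volume.prod μ) := by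
    refine ((integrable_exp_neg_mul_sq_norm hr).mul_prod (integrable_const (1 : ℝ))).mono'
      (Continuous.aestronglyMeasurable (by fun_prop)) (.of_forall fun p => ?_)
    rw [norm_mul, norm_exp_ofReal_mul_I, norm_real, Real.norm_of_nonneg (Real.exp_pos _).le,
      one_mul, mul_one]
  calc ∫ x, charFun μ x * (Real.exp (-r * ‖x‖ ^ 2) : ℂ)
      = ∫ x, ∫ z, cexp (⟪z, x⟫ * I) * (Real.exp (-r * ‖x‖ ^ 2) : ℂ) ∂μ := by
        simp_rw [charFun_apply, integral_mul_const]
    _ = ∫ z, (∫ x, cexp (⟪z, x⟫ * I) * (Real.exp (-r * ‖x‖ ^ 2) : ℂ)) ∂μ :=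
        integral_integral_swap hint
    _ = _ := by
        simp_rw [integral_exp_inner_mul_gaussian hr]
        rw [integral_complex_ofReal, integral_const_mul]

theorem integral_charFun_eq_zero {μ : Measure E} [IsFiniteMeasure μ]
    (hi : Integrable (charFun μ)) (h0 : (0 : E) ∉ μ.support) : ∫ x, charFun μ x = 0 := by
  obtain ⟨U, hU, hμU⟩ := Measure.notMem_support_iff_exists.mp h0
  obtain ⟨ρ, hρ, hρU⟩ := Metric.mem_nhds_iff.mp hU
  have hball : μ (Metric.ball 0 ρ) = 0 := measure_mono_null hρU hμU
  set d : ℝ := finrank ℝ E / 2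
  refine tendsto_nhds_unique (Real.tendsto_integral_cexp_sq_smul hi)
    (squeeze_zero_norm' (a := fun c : ℝ => Real.pi ^ d * μ.real Set.univ *
      (c ^ d * Real.exp (-(ρ ^ 2 / 4) * c))) ?_ ?_)
  · filter_upwards [eventually_gt_atTop 0] with c hc
    have hmean := integral_charFun_mul_gaussian μ (inv_pos.mpr hc)
    have hle := integral_exp_neg_sq_norm_div_le hρ.le hball (inv_pos.mpr hc)
    calc ‖∫ x, cexp (-(c⁻¹ : ℝ) * ‖x‖ ^ 2) • charFun μ x‖
        = ‖∫ x, charFun μ x * (Real.exp (-c⁻¹ * ‖x‖ ^ 2) : ℂ)‖ := by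
          congr 2 with x
          rw [smul_eq_mul, mul_comm]
          push_cast
          rfl
      _ = (Real.pi / c⁻¹) ^ d * ∫ z, Real.exp (-‖z‖ ^ 2 / (4 * c⁻¹)) ∂μ := by
          rw [hmean, norm_real, Real.norm_of_nonneg (by positivity)]
      _ ≤ (Real.pi / c⁻¹) ^ d * (μ.real Set.univ * Real.exp (-ρ ^ 2 / (4 * c⁻¹))) := by gcongr
      _ = _ := by
          have hexp : -ρ ^ 2 / (4 * c⁻¹) = -(ρ ^ 2 / 4) * c := by field_simp
          rw [div_inv_eq_mul, Real.mul_rpow Real.pi_pos.le hc.le, hexp]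
          ring
  · simpa using (tendsto_rpow_mul_exp_neg_mul_atTop_nhds_zero d (ρ ^ 2 / 4)
      (by positivity)).const_mul (Real.pi ^ d * μ.real Set.univ)

end GaussianMeans

section Support

theorem support_map_subset {X Y : Type*} [TopologicalSpace X] [MeasurableSpace X]
    [OpensMeasurableSpace X] [HereditarilyLindelofSpace X] [TopologicalSpace Y] [T2Space Y]
    [MeasurableSpace Y] [BorelSpace Y] {μ : Measure X} {f : X → Y} (hf : Continuous f)
    (hμ : IsCompact μ.support) : (μ.map f).support ⊆ f '' μ.support := by
  have hclosed : IsClosed (f '' μ.support) := (hμ.image hf).isClosed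
  refine Measure.support_subset_of_isClosed hclosed
    (mem_ae_map_iff hf.aemeasurable hclosed.measurableSet |>.mpr ?_)
  exact mem_of_superset Measure.support_mem_ae (Set.subset_preimage_image f _)

variable {E : Type*} [NormedAddCommGroup E] [MeasurableSpace E] [BorelSpace E]
  [SecondCountableTopology E] {μ ν : Measure E}

theorem support_map_add_const_subset (μ : Measure E) (y : E) :
    (μ.map (· + y)).support ⊆ (· + y) '' μ.support := by
  have hclosed : IsClosed ((· + y) '' μ.support) :=
    (Homeomorph.addRight y).isClosedMap _ Measure.isClosed_support
  refine Measure.support_subset_of_isClosed hclosed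
    (mem_ae_map_iff (by fun_prop) hclosed.measurableSet |>.mpr ?_)
  exact mem_of_superset Measure.support_mem_ae (Set.subset_preimage_image _ _)

/-- The distribution of `x - y` under `μ × ν`. Its characteristic function is `μ̂ · conj ν̂`, and
`I_s(μ)` is its `-s`-th moment when `μ = ν`. -/
def diffMeasure (μ ν : Measure E) : Measure E := (μ.prod ν).map fun p => p.1 - p.2

instance (μ ν : Measure E) [IsFiniteMeasure μ] [IsFiniteMeasure ν] :
    IsFiniteMeasure (diffMeasure μ ν) := by
  unfold diffMeasure; infer_instance

open scoped Pointwise in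
theorem support_diffMeasure_subset [SFinite μ] [SFinite ν] (hμ : IsCompact μ.support)
    (hν : IsCompact ν.support) : (diffMeasure μ ν).support ⊆ μ.support - ν.support := by
  have hclosed : IsClosed (μ.support - ν.support) := by
    rw [← Set.sub_image_prod]
    exact ((hμ.prod hν).image continuous_sub).isClosed
  refine Measure.support_subset_of_isClosed hclosed
    (mem_ae_map_iff (by fun_prop) hclosed.measurableSet |>.mpr ?_)
  filter_upwards [Measure.quasiMeasurePreserving_fst.ae (Measure.support_mem_ae (μ := μ)),
    Measure.quasiMeasurePreserving_snd.ae (Measure.support_mem_ae (μ := ν))]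
    with p hp₁ hp₂ using Set.sub_mem_sub hp₁ hp₂

theorem lintegral_diffMeasure [SFinite μ] [SFinite ν] {f : E → ℝ≥0∞} (hf : Measurable f) :
    ∫⁻ z, f z ∂diffMeasure μ ν = ∫⁻ y, ∫⁻ x, f (x - y) ∂μ ∂ν := by
  rw [diffMeasure, lintegral_map hf (by fun_prop), lintegral_prod_symm' _ (by fun_prop)]

theorem charFun_diffMeasure [InnerProductSpace ℝ E] [IsFiniteMeasure μ] [IsFiniteMeasure ν]
    (t : E) : charFun (diffMeasure μ ν) t = charFun μ t * conj (charFun ν t) := by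
  rw [diffMeasure, charFun_apply, integral_map (by fun_prop)
    (Continuous.aestronglyMeasurable (by fun_prop)), ← charFun_neg, charFun_apply, charFun_apply,
    ← integral_prod_mul]
  congr 1 with p
  simp only [inner_sub_left, inner_neg_right]
  rw [← Complex.exp_add]
  push_cast
  ring_nf

theorem diffMeasure_ne_zero [SFinite μ] [SFinite ν] (hμ : μ ≠ 0) (hν : ν ≠ 0) :
    diffMeasure μ ν ≠ 0 := by
  rw [diffMeasure, Measure.map_ne_zero_iff (by fun_prop), ← Measure.measure_univ_ne_zero,
    ← Set.univ_prod_univ, Measure.prod_prod]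
  exact mul_ne_zero (Measure.measure_univ_ne_zero.mpr hμ) (Measure.measure_univ_ne_zero.mpr hν)

end Support

section Density

variable {E : Type*} [NormedAddCommGroup E] [InnerProductSpace ℝ E] [FiniteDimensional ℝ E]
  [MeasurableSpace E] [BorelSpace E] {μ ν : Measure E}

/-- The Fourier transform of `ξ ↦ μ̂(2πξ)`, which is the continuous density of `μ` when `μ̂` is
integrable. The factor `2π` translates between the normalisations of `charFun` and `𝓕`. -/
def charFunDensity (μ : Measure E) : E → ℂ := 𝓕 fun ξ : E => charFun μ ((2 * Real.pi) • ξ)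

theorem integrable_charFun_two_pi (hi : Integrable (charFun μ)) :
    Integrable fun ξ : E => charFun μ ((2 * Real.pi) • ξ) :=
  hi.comp_smul Real.two_pi_pos.ne'

theorem continuous_charFunDensity (hi : Integrable (charFun μ)) :
    Continuous (charFunDensity μ) :=
  VectorFourier.fourierIntegral_continuous Real.continuous_fourierChar
    continuous_inner (integrable_charFun_two_pi hi)

variable [IsFiniteMeasure μ] [IsFiniteMeasure ν]

theorem charFunDensity_eq_zero (hi : Integrable (charFun μ)) {y : E} (hy : y ∉ μ.support) :
    charFunDensity μ y = 0 := by
  have hshift (t : E) : charFun (μ.map (· + -y)) t = charFun μ t * cexp (⟪-y, t⟫ * I) :=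
    charFun_map_add_const _ _
  have h0 : (0 : E) ∉ (μ.map (· + -y)).support := fun h => by
    obtain ⟨x, hx, hxy⟩ := support_map_add_const_subset μ (-y) h
    exact hy (add_neg_eq_zero.mp hxy ▸ hx)
  have hint : Integrable (charFun (μ.map (· + -y))) := by
    refine hi.mono measurable_charFun.aestronglyMeasurable (.of_forall fun t => ?_)
    rw [hshift, norm_mul, norm_exp_ofReal_mul_I, mul_one]
  calc charFunDensity μ y = ∫ ξ : E, charFun (μ.map (· + -y)) ((2 * Real.pi) • ξ) := by
        rw [charFunDensity, Real.fourier_eq']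
        congr 1 with ξ
        rw [hshift, smul_eq_mul, mul_comm, inner_neg_left, real_inner_smul_right,
          real_inner_comm]
        push_cast
        ring_nf
    _ = 0 := by
        rw [Measure.integral_comp_smul, integral_charFun_eq_zero hint h0, smul_zero]

theorem support_charFunDensity_subset (hi : Integrable (charFun μ)) :
    Function.support (charFunDensity μ) ⊆ μ.support := fun _ hx =>
  by_contra fun hy => hx (charFunDensity_eq_zero hi hy)

theorem integrable_charFunDensity (hμ : IsCompact μ.support) (hi : Integrable (charFun μ)) :
    Integrable (charFunDensity μ) :=
  (continuous_charFunDensity hi).integrable_of_hasCompactSupport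
    (HasCompactSupport.of_support_subset_isCompact hμ (support_charFunDensity_subset hi))

theorem fourier_charFunDensity (hμ : IsCompact μ.support) (hi : Integrable (charFun μ)) (ξ : E) :
    𝓕 (charFunDensity μ) ξ = conj (charFun μ ((2 * Real.pi) • ξ)) := by
  have hinv := congrFun (Continuous.fourierInv_fourier_eq (continuous_charFun.comp' (by fun_prop))
    (integrable_charFun_two_pi hi) (integrable_charFunDensity hμ hi)) (-ξ)
  rw [Real.fourierInv_eq_fourier_neg, neg_neg] at hinv
  rw [charFunDensity, hinv, smul_neg, charFun_neg]

theorem integral_charFunDensity_mul (hν : IsCompact ν.support) (hiμ : Integrable (charFun μ))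
    (hiν : Integrable (charFun ν)) :
    ∫ x, charFunDensity μ x * charFunDensity ν x =
      ∫ ξ : E, charFun (diffMeasure μ ν) ((2 * Real.pi) • ξ) :=
  calc ∫ x, charFunDensity μ x * charFunDensity ν x
      = ∫ ξ : E, charFun μ ((2 * Real.pi) • ξ) * 𝓕 (charFunDensity ν) ξ := by
        simpa using! VectorFourier.integral_fourierIntegral_smul_eq_flip (L := innerₗ E)
          Real.continuous_fourierChar continuous_inner (integrable_charFun_two_pi hiμ)
          (integrable_charFunDensity hν hiν)
    _ = _ := by simp_rw [fourier_charFunDensity hν hiν, charFun_diffMeasure]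

theorem support_inter_nonempty_of_integral_charFun_ne_zero (hμ : IsCompact μ.support)
    (hν : IsCompact ν.support) (hi : Integrable (charFun (diffMeasure μ ν)))
    (h0 : ∫ x, charFun (diffMeasure μ ν) x ≠ 0) : (μ.support ∩ ν.support).Nonempty := by
  contrapose! h0 with hdisj
  refine integral_charFun_eq_zero hi fun hzero => ?_
  obtain ⟨x, hx, y, hy, hxy⟩ := support_diffMeasure_subset hμ hν hzero
  obtain rfl : x = y := sub_eq_zero.mp hxy
  exact Set.notMem_empty x (hdisj ▸ ⟨hx, hy⟩)

theorem interior_support_inter_nonempty_of_integral_charFun_ne_zero (hν : IsCompact ν.support)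
    (hiμ : Integrable (charFun μ)) (hiν : Integrable (charFun ν))
    (h0 : ∫ x, charFun (diffMeasure μ ν) x ≠ 0) :
    (interior (μ.support ∩ ν.support)).Nonempty := by
  have hne : ∫ x, charFunDensity μ x * charFunDensity ν x ≠ 0 := by
    rw [integral_charFunDensity_mul hν hiμ hiν, Measure.integral_comp_smul]
    exact smul_ne_zero (by positivity) h0
  obtain ⟨x, hx⟩ : ∃ x, charFunDensity μ x * charFunDensity ν x ≠ 0 := by
    contrapose! hne
    simp [hne]
  refine ⟨x, mem_interior.mpr
    ⟨Function.support fun x => charFunDensity μ x * charFunDensity ν x, ?_, ?_, hx⟩⟩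
  · rw [Function.support_mul]
    exact Set.inter_subset_inter (support_charFunDensity_subset hiμ)
      (support_charFunDensity_subset hiν)
  · exact ((continuous_charFunDensity hiμ).mul (continuous_charFunDensity hiν)).isOpen_support

end Density

section GaussianMixture

variable {E : Type*} [NormedAddCommGroup E]

theorem integral_rpow_mul_exp_neg_mul_sq_norm {a : ℝ} (ha : 0 < a) {x : E} (hx : x ≠ 0) :
    ∫ r in Set.Ioi (0 : ℝ), r ^ (a - 1) * Real.exp (-r * ‖x‖ ^ 2) =
      Real.Gamma a * ‖x‖ ^ (-(2 * a)) := by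
  have hx' : 0 < ‖x‖ := norm_pos_iff.mpr hx
  simp_rw [neg_mul, mul_comm _ (‖x‖ ^ 2)]
  rw [Real.integral_rpow_mul_exp_neg_mul_Ioi ha (by positivity), mul_comm, one_div,
    ← Real.rpow_natCast, ← Real.rpow_neg hx'.le, ← Real.rpow_mul hx'.le]
  push_cast
  ring_nf

theorem integrableOn_rpow_mul_exp_neg_mul_sq_norm {a : ℝ} (ha : 0 < a) {x : E} (hx : x ≠ 0) :
    IntegrableOn (fun r : ℝ => r ^ (a - 1) * Real.exp (-r * ‖x‖ ^ 2)) (Set.Ioi 0) := by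
  have := Real.Gamma_pos_of_pos ha
  refine .of_integral_ne_zero ?_
  rw [integral_rpow_mul_exp_neg_mul_sq_norm ha hx]
  positivity

/-- The mixture `∫₀^∞ r ^ (a - 1) exp (-r ‖x‖²) dr` of Gaussians. It equals `Γ(a) ‖x‖ ^ (-2 a)` for
`a > 0`, which reduces statements about Riesz kernels to statements about Gaussians. -/
def gaussianMixture (a : ℝ) (x : E) : ℝ≥0∞ :=
  ∫⁻ r in Set.Ioi (0 : ℝ), ENNReal.ofReal (r ^ (a - 1) * Real.exp (-r * ‖x‖ ^ 2))

theorem ae_rpow_mul_exp_nonneg (a : ℝ) (x : E) :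
    0 ≤ᵐ[volume.restrict (Set.Ioi 0)] fun r : ℝ => r ^ (a - 1) * Real.exp (-r * ‖x‖ ^ 2) := by
  filter_upwards [ae_restrict_mem measurableSet_Ioi] with r hr
  exact mul_nonneg (Real.rpow_nonneg (le_of_lt hr) _) (Real.exp_pos _).le

theorem gaussianMixture_eq_top_of_not_integrableOn {a : ℝ} {x : E}
    (h : ¬ IntegrableOn (fun r : ℝ => r ^ (a - 1) * Real.exp (-r * ‖x‖ ^ 2)) (Set.Ioi 0)) :
    gaussianMixture a x = ⊤ := by
  contrapose! h
  exact (lintegral_ofReal_ne_top_iff_integrable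
    (Measurable.aestronglyMeasurable (by fun_prop)) (ae_rpow_mul_exp_nonneg a x)).mp h

theorem gaussianMixture_zero (a : ℝ) : gaussianMixture a (0 : E) = ⊤ := by
  refine gaussianMixture_eq_top_of_not_integrableOn ?_
  simpa using not_integrableOn_Ioi_rpow (a - 1)

theorem gaussianMixture_of_nonpos {a : ℝ} (ha : a ≤ 0) (x : E) : gaussianMixture a x = ⊤ := by
  refine gaussianMixture_eq_top_of_not_integrableOn fun hi => ?_
  have hbound := (hi.mono_set (s := Set.Ioo 0 1) Set.Ioo_subset_Ioi_self).const_mul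
    (Real.exp (‖x‖ ^ 2))
  have hpow : IntegrableOn (fun r : ℝ => r ^ (a - 1)) (Set.Ioo 0 1) := by
    refine hbound.mono' (Measurable.aestronglyMeasurable (by fun_prop)) ?_
    filter_upwards [ae_restrict_mem measurableSet_Ioo] with r hr
    have hr' := Real.rpow_pos_of_pos hr.1 (a - 1)
    rw [Real.norm_of_nonneg hr'.le, mul_left_comm, ← Real.exp_add]
    refine le_mul_of_one_le_right hr'.le (Real.one_le_exp ?_)
    nlinarith [hr.2, sq_nonneg ‖x‖]
  have := (intervalIntegral.integrableOn_Ioo_rpow_iff one_pos).mp hpow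
  linarith

theorem gaussianMixture_of_pos {a : ℝ} (ha : 0 < a) (x : E) :
    gaussianMixture a x = ENNReal.ofReal (Real.Gamma a) * ‖x‖ₑ ^ (-(2 * a)) := by
  have hΓ := Real.Gamma_pos_of_pos ha
  rcases eq_or_ne x 0 with rfl | hx
  · rw [gaussianMixture_zero, enorm_zero, ENNReal.zero_rpow_of_neg (by linarith),
      ENNReal.mul_top (by simpa using hΓ)]
  · rw [gaussianMixture, ← ofReal_integral_eq_lintegral_ofReal
      (integrableOn_rpow_mul_exp_neg_mul_sq_norm ha hx) (ae_rpow_mul_exp_nonneg a x),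
      integral_rpow_mul_exp_neg_mul_sq_norm ha hx, ENNReal.ofReal_mul hΓ.le, ← ofReal_norm,
      ENNReal.ofReal_rpow_of_pos (norm_pos_iff.mpr hx)]

theorem lintegral_Ioi_comp_inv (f : ℝ → ℝ≥0∞) :
    ∫⁻ r in Set.Ioi 0, ENNReal.ofReal (r ^ 2)⁻¹ * f r⁻¹ = ∫⁻ r in Set.Ioi 0, f r := by
  have himage : (·⁻¹) '' Set.Ioi (0 : ℝ) = Set.Ioi 0 := by
    ext r
    simp [Set.image_inv_eq_inv]
  conv_rhs => rw [← himage]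
  rw [lintegral_image_eq_lintegral_abs_deriv_mul measurableSet_Ioi
    (fun r hr => (hasDerivAt_inv (ne_of_gt hr)).hasDerivWithinAt) inv_injective.injOn]
  simp

theorem lintegral_rpow_mul_exp_neg_sq_norm_div [NormedSpace ℝ E] (a : ℝ) (x : E) :
    ∫⁻ r in Set.Ioi (0 : ℝ), ENNReal.ofReal (r ^ (-a - 1) * Real.exp (-‖x‖ ^ 2 / (4 * r))) =
      gaussianMixture a ((2⁻¹ : ℝ) • x) := by
  rw [gaussianMixture]
  conv_rhs => rw [← lintegral_Ioi_comp_inv]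
  refine setLIntegral_congr_fun measurableSet_Ioi fun r (hr : 0 < r) => ?_
  have hpow : r ^ (-a - 1) = (r ^ 2)⁻¹ * r⁻¹ ^ (a - 1) := by
    rw [← Real.rpow_natCast, ← Real.rpow_neg hr.le, Real.inv_rpow hr.le, ← Real.rpow_neg hr.le,
      ← Real.rpow_add hr]
    push_cast
    ring_nf
  have hexp : -‖x‖ ^ 2 / (4 * r) = -r⁻¹ * ‖(2⁻¹ : ℝ) • x‖ ^ 2 := by
    rw [norm_smul, mul_pow]
    norm_num
    field_simp
  rw [← ENNReal.ofReal_mul (by positivity), hpow, hexp, mul_assoc]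

theorem lintegral_gaussianMixture_smul_lt_top [NormedSpace ℝ E] [MeasurableSpace E] [BorelSpace E]
    {μ : Measure E} {s : ℝ} (hs : 0 < s) (hE : ∫⁻ z, ‖z‖ₑ ^ (-s) ∂μ < ⊤) :
    ∫⁻ z, gaussianMixture (s / 2) ((2⁻¹ : ℝ) • z) ∂μ < ⊤ := by
  have h2 : ‖(2⁻¹ : ℝ)‖ₑ ≠ 0 := by simp
  have hpt (z : E) : gaussianMixture (s / 2) ((2⁻¹ : ℝ) • z) =
      (ENNReal.ofReal (Real.Gamma (s / 2)) * ‖(2⁻¹ : ℝ)‖ₑ ^ (-s)) * ‖z‖ₑ ^ (-s) := by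
    rw [gaussianMixture_of_pos (half_pos hs), enorm_smul,
      ENNReal.mul_rpow_of_ne_top (by simp) (by simp), mul_div_cancel₀ _ two_ne_zero]
    ring
  simp_rw [hpt]
  rw [lintegral_const_mul _ (by fun_prop)]
  exact ENNReal.mul_lt_top (ENNReal.mul_lt_top ENNReal.ofReal_lt_top
    (ENNReal.rpow_ne_top_of_ne_zero h2 (by simp)).lt_top) hE

end GaussianMixture

section RieszKernel

variable {E : Type*} [NormedAddCommGroup E] [InnerProductSpace ℝ E] [FiniteDimensional ℝ E]
  [MeasurableSpace E] [BorelSpace E] {μ : Measure E} [IsFiniteMeasure μ]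

theorem lintegral_enorm_charFun_mul_gaussian (hμ : ∀ x, charFun μ x = (‖charFun μ x‖ : ℂ)) {r : ℝ}
    (hr : 0 < r) :
    ∫⁻ x, ‖charFun μ x‖ₑ * ENNReal.ofReal (Real.exp (-r * ‖x‖ ^ 2)) =
      ENNReal.ofReal ((Real.pi / r) ^ (finrank ℝ E / 2 : ℝ)) *
        ∫⁻ z, ENNReal.ofReal (Real.exp (-‖z‖ ^ 2 / (4 * r))) ∂μ := by
  have hint : Integrable fun x => ‖charFun μ x‖ * Real.exp (-r * ‖x‖ ^ 2) :=
    (integrable_exp_neg_mul_sq_norm hr).bdd_mul (c := μ.real Set.univ)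
      measurable_charFun.norm.aestronglyMeasurable
      (.of_forall fun x => by simpa using norm_charFun_le x)
  have hmean : ∫ x, ‖charFun μ x‖ * Real.exp (-r * ‖x‖ ^ 2) =
      (Real.pi / r) ^ (finrank ℝ E / 2 : ℝ) * ∫ z, Real.exp (-‖z‖ ^ 2 / (4 * r)) ∂μ := by
    rw [← ofReal_inj, ← integral_charFun_mul_gaussian μ hr, ← integral_complex_ofReal]
    congr 1 with x
    rw [ofReal_mul, ← hμ]
  calc _ = ∫⁻ x, ENNReal.ofReal (‖charFun μ x‖ * Real.exp (-r * ‖x‖ ^ 2)) := by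
        simp_rw [ENNReal.ofReal_mul (norm_nonneg _), ofReal_norm]
    _ = _ := by
        rw [← ofReal_integral_eq_lintegral_ofReal hint (.of_forall fun x => by positivity), hmean,
          ENNReal.ofReal_mul (by positivity), ofReal_integral_eq_lintegral_ofReal
          (integrable_exp_neg_sq_norm_div μ hr) (.of_forall fun z => (Real.exp_pos _).le)]

theorem lintegral_mul_gaussianMixture {F : Type*} [NormedAddCommGroup F] [MeasurableSpace F]
    [BorelSpace F] (ν : Measure F) [SFinite ν] {f : F → ℝ≥0∞} (hf : Measurable f) (a : ℝ) :
    ∫⁻ x, f x * gaussianMixture a x ∂ν = ∫⁻ r in Set.Ioi (0 : ℝ),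
      ENNReal.ofReal (r ^ (a - 1)) * ∫⁻ x, f x * ENNReal.ofReal (Real.exp (-r * ‖x‖ ^ 2)) ∂ν := by
  calc _ = ∫⁻ x, (∫⁻ r in Set.Ioi (0 : ℝ),
        f x * ENNReal.ofReal (r ^ (a - 1) * Real.exp (-r * ‖x‖ ^ 2))) ∂ν := by
        congr 1 with x
        rw [gaussianMixture, lintegral_const_mul _ (by fun_prop)]
    _ = ∫⁻ r in Set.Ioi (0 : ℝ), ∫⁻ x,
        f x * ENNReal.ofReal (r ^ (a - 1) * Real.exp (-r * ‖x‖ ^ 2)) ∂ν := by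
        refine lintegral_lintegral_swap (Measurable.aemeasurable ?_)
        simp only [Function.uncurry_def]
        fun_prop
    _ = _ := by
        refine setLIntegral_congr_fun measurableSet_Ioi fun r (hr : 0 < r) => ?_
        rw [← lintegral_const_mul _ (by fun_prop)]
        congr 1 with x
        rw [ENNReal.ofReal_mul (by positivity), mul_left_comm]

theorem lintegral_enorm_charFun_mul_gaussianMixture
    (hμ : ∀ x, charFun μ x = (‖charFun μ x‖ : ℂ)) (s : ℝ) :
    ∫⁻ x, ‖charFun μ x‖ₑ * gaussianMixture ((finrank ℝ E - s) / 2) x =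
      ENNReal.ofReal (Real.pi ^ (finrank ℝ E / 2 : ℝ)) *
        ∫⁻ z, gaussianMixture (s / 2) ((2⁻¹ : ℝ) • z) ∂μ := by
  set d : ℝ := (finrank ℝ E : ℝ)
  have hweight {r : ℝ} (hr : 0 < r) : r ^ ((d - s) / 2 - 1) * (Real.pi / r) ^ (d / 2) =
      Real.pi ^ (d / 2) * r ^ (-(s / 2) - 1) := by
    rw [Real.div_rpow Real.pi_pos.le hr.le, div_eq_mul_inv (Real.pi ^ _), ← Real.rpow_neg hr.le,
      mul_left_comm, ← Real.rpow_add hr]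
    ring_nf
  calc _ = ∫⁻ r in Set.Ioi (0 : ℝ), ENNReal.ofReal (r ^ ((d - s) / 2 - 1)) *
        ∫⁻ x, ‖charFun μ x‖ₑ * ENNReal.ofReal (Real.exp (-r * ‖x‖ ^ 2)) :=
        lintegral_mul_gaussianMixture _ measurable_charFun.enorm _
    _ = ∫⁻ r in Set.Ioi (0 : ℝ), ENNReal.ofReal (Real.pi ^ (d / 2)) *
        ∫⁻ z, ENNReal.ofReal (r ^ (-(s / 2) - 1) * Real.exp (-‖z‖ ^ 2 / (4 * r))) ∂μ := by
        refine setLIntegral_congr_fun measurableSet_Ioi fun r (hr : 0 < r) => ?_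
        rw [lintegral_enorm_charFun_mul_gaussian hμ hr, ← mul_assoc,
          ← ENNReal.ofReal_mul (by positivity), hweight hr, ENNReal.ofReal_mul (by positivity),
          mul_assoc, ← lintegral_const_mul _ (by fun_prop)]
        simp_rw [ENNReal.ofReal_mul (Real.rpow_nonneg hr.le _)]
    _ = ENNReal.ofReal (Real.pi ^ (d / 2)) * ∫⁻ z, (∫⁻ r in Set.Ioi (0 : ℝ),
        ENNReal.ofReal (r ^ (-(s / 2) - 1) * Real.exp (-‖z‖ ^ 2 / (4 * r)))) ∂μ := by
        have hmeas : Measurable fun p : ℝ × E =>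
            ENNReal.ofReal (p.1 ^ (-(s / 2) - 1) * Real.exp (-‖p.2‖ ^ 2 / (4 * p.1))) := by fun_prop
        rw [lintegral_const_mul _ hmeas.lintegral_prod_right',
          lintegral_lintegral_swap hmeas.aemeasurable]
    _ = _ := by simp_rw [lintegral_rpow_mul_exp_neg_sq_norm_div]

theorem lt_finrank_of_lintegral_rpow_lt_top (h0 : μ ≠ 0)
    (hμ : ∀ x, charFun μ x = (‖charFun μ x‖ : ℂ)) {s : ℝ} (hs : 0 < s)
    (hE : ∫⁻ z, ‖z‖ₑ ^ (-s) ∂μ < ⊤) : s < finrank ℝ E := by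
  by_contra! hds
  have hlt := (lintegral_enorm_charFun_mul_gaussianMixture hμ s).trans_lt
    (ENNReal.mul_lt_top ENNReal.ofReal_lt_top (lintegral_gaussianMixture_smul_lt_top hs hE))
  simp_rw [gaussianMixture_of_nonpos (show (finrank ℝ E - s) / 2 ≤ 0 by linarith)] at hlt
  rw [lintegral_mul_const _ measurable_charFun.enorm] at hlt
  have hzero : ∫⁻ x, ‖charFun μ x‖ₑ = 0 := by
    contrapose! hlt
    rw [ENNReal.mul_top hlt]
  have hcharFun : charFun μ = 0 := by
    refine (Continuous.ae_eq_iff_eq volume continuous_charFun continuous_zero).mp ?_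
    filter_upwards [(lintegral_eq_zero_iff measurable_charFun.enorm).mp hzero] with x hx
    simpa using hx
  have huniv : μ.real Set.univ = 0 := by simpa using congrFun hcharFun 0
  exact h0 (Measure.measure_univ_eq_zero.mp
    ((measureReal_eq_zero_iff (measure_ne_top μ _)).mp huniv))

theorem lintegral_enorm_charFun_mul_rpow_lt_top (hμ : ∀ x, charFun μ x = (‖charFun μ x‖ : ℂ))
    {s : ℝ} (hs : 0 < s) (hE : ∫⁻ z, ‖z‖ₑ ^ (-s) ∂μ < ⊤) :
    ∫⁻ x, ‖charFun μ x‖ₑ * ‖x‖ₑ ^ (s - finrank ℝ E) < ⊤ := by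
  rcases eq_or_ne μ 0 with rfl | h0
  · simp
  have hlt := (lintegral_enorm_charFun_mul_gaussianMixture hμ s).trans_lt
    (ENNReal.mul_lt_top ENNReal.ofReal_lt_top (lintegral_gaussianMixture_smul_lt_top hs hE))
  have ha : 0 < (finrank ℝ E - s) / 2 := by
    linarith [lt_finrank_of_lintegral_rpow_lt_top h0 hμ hs hE]
  have hΓ : ENNReal.ofReal (Real.Gamma ((finrank ℝ E - s) / 2)) ≠ 0 := by
    simpa using Real.Gamma_pos_of_pos ha
  have hexp : -(2 * ((finrank ℝ E - s) / 2)) = s - finrank ℝ E := by ring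
  simp_rw [gaussianMixture_of_pos ha, hexp, mul_left_comm _ (ENNReal.ofReal _)] at hlt
  rw [lintegral_const_mul' _ _ ENNReal.ofReal_ne_top] at hlt
  exact ENNReal.lt_top_of_mul_ne_top_right hlt.ne hΓ

end RieszKernel

section Energy

variable {n : ℕ} {μ : Measure (Eucl n)} [IsFiniteMeasure μ] {s : ℝ}

theorem energy_eq_lintegral_diffMeasure (s : ℝ) (μ : Measure (Eucl n)) [SFinite μ] :
    energy s μ = ∫⁻ z, ‖z‖ₑ ^ (-s) ∂diffMeasure μ μ := by
  rw [lintegral_diffMeasure (by fun_prop), energy]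

theorem charFun_diffMeasure_self (μ : Measure (Eucl n)) [IsFiniteMeasure μ] (x : Eucl n) :
    charFun (diffMeasure μ μ) x = (‖charFun μ x‖ ^ 2 : ℝ) := by
  rw [charFun_diffMeasure, mul_conj, normSq_eq_norm_sq]

theorem charFun_diffMeasure_self_eq_norm (μ : Measure (Eucl n)) [IsFiniteMeasure μ] (x : Eucl n) :
    charFun (diffMeasure μ μ) x = (‖charFun (diffMeasure μ μ) x‖ : ℂ) := by
  rw [charFun_diffMeasure_self, norm_real, norm_pow, norm_norm]

theorem lt_of_energy_lt_top (h0 : μ ≠ 0) (hs : 0 < s) (hE : energy s μ < ⊤) : s < n := by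
  rw [energy_eq_lintegral_diffMeasure] at hE
  simpa using lt_finrank_of_lintegral_rpow_lt_top (diffMeasure_ne_zero h0 h0)
    (charFun_diffMeasure_self_eq_norm μ) hs hE

theorem lintegral_enorm_charFun_sq_mul_rpow_lt_top (hs : 0 < s) (hE : energy s μ < ⊤) :
    ∫⁻ x, ‖charFun μ x‖ₑ ^ 2 * ‖x‖ₑ ^ (s - n) < ⊤ := by
  rw [energy_eq_lintegral_diffMeasure] at hE
  have hlt := lintegral_enorm_charFun_mul_rpow_lt_top (charFun_diffMeasure_self_eq_norm μ) hs hE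
  simpa [charFun_diffMeasure, sq] using hlt

end Energy

section RieszPositivity

variable {E : Type*} [NormedAddCommGroup E] [InnerProductSpace ℝ E] [FiniteDimensional ℝ E]
  [MeasurableSpace E] [BorelSpace E]

/-- The measure `‖x‖ ^ p dx`. Its density is `∞` at `0` when `p < 0`, which is negligible. -/
def rieszMeasure (E : Type*) [NormedAddCommGroup E] [InnerProductSpace ℝ E]
    [FiniteDimensional ℝ E] [MeasurableSpace E] [BorelSpace E] (p : ℝ) : Measure E :=
  volume.withDensity fun x => ‖x‖ₑ ^ p

theorem lintegral_rieszMeasure (p : ℝ) {f : E → ℝ≥0∞} (hf : Measurable f) :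
    ∫⁻ x, f x ∂rieszMeasure E p = ∫⁻ x, f x * ‖x‖ₑ ^ p := by
  rw [rieszMeasure, lintegral_withDensity_eq_lintegral_mul _ (by fun_prop) hf]
  simp only [Pi.mul_apply, mul_comm]

theorem integral_rieszMeasure [Nontrivial E] (p : ℝ) (f : E → ℂ) :
    ∫ x, f x ∂rieszMeasure E p = ∫ x, f x * (‖x‖ ^ p : ℝ) := by
  have hfinite : ∀ᵐ x : E, ‖x‖ₑ ^ p < ⊤ := by
    filter_upwards [Measure.ae_ne volume 0] with x hx
    exact (ENNReal.rpow_ne_top_of_ne_zero (by simpa using hx) (by simp)).lt_top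
  rw [rieszMeasure, integral_withDensity_eq_integral_toReal_smul (by fun_prop) hfinite]
  congr 1 with x
  rw [← ENNReal.toReal_rpow, toReal_enorm, real_smul, mul_comm]

variable {μ : Measure E} [IsFiniteMeasure μ] {a : ℝ}

theorem integral_charFun_mul_rpow_mul_gaussian (μ : Measure E) [IsFiniteMeasure μ] (a : ℝ) {r : ℝ}
    (hr : 0 < r) :
    ∫ x, charFun μ x * (r ^ (a - 1) * Real.exp (-r * ‖x‖ ^ 2) : ℝ) =
      (r ^ (a - 1) * ((Real.pi / r) ^ (finrank ℝ E / 2 : ℝ) *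
        ∫ z, Real.exp (-‖z‖ ^ 2 / (4 * r)) ∂μ) : ℝ) := by
  rw [ofReal_mul, ← integral_charFun_mul_gaussian μ hr, ← integral_const_mul]
  congr 1 with x
  rw [ofReal_mul, mul_left_comm]

theorem integrable_charFun_mul_gaussian_prod (ha : 0 < a)
    (hi : Integrable (charFun μ) (rieszMeasure E (-(2 * a)))) :
    Integrable (fun p : E × ℝ =>
        charFun μ p.1 * (p.2 ^ (a - 1) * Real.exp (-p.2 * ‖p.1‖ ^ 2) : ℝ))
      (volume.prod (volume.restrict (Set.Ioi 0))) := by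
  have hmeas : Measurable fun p : E × ℝ =>
      charFun μ p.1 * (p.2 ^ (a - 1) * Real.exp (-p.2 * ‖p.1‖ ^ 2) : ℝ) := by fun_prop
  refine ⟨hmeas.aestronglyMeasurable, hasFiniteIntegral_iff_enorm.mpr ?_⟩
  have hinner (x : E) : ∫⁻ r in Set.Ioi (0 : ℝ),
      ‖charFun μ x * (r ^ (a - 1) * Real.exp (-r * ‖x‖ ^ 2) : ℝ)‖ₑ =
      ENNReal.ofReal (Real.Gamma a) * (‖charFun μ x‖ₑ * ‖x‖ₑ ^ (-(2 * a))) := by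
    rw [mul_left_comm, ← gaussianMixture_of_pos ha, gaussianMixture,
      ← lintegral_const_mul _ (by fun_prop)]
    refine setLIntegral_congr_fun measurableSet_Ioi fun r (hr : 0 < r) => ?_
    rw [enorm_mul, ← ofReal_norm (ofReal _), norm_real, Real.norm_of_nonneg (by positivity)]
  rw [lintegral_prod _ hmeas.enorm.aemeasurable]
  simp_rw [hinner]
  rw [lintegral_const_mul' _ _ ENNReal.ofReal_ne_top,
    ← lintegral_rieszMeasure _ measurable_charFun.enorm]
  exact ENNReal.mul_lt_top ENNReal.ofReal_lt_top hi.hasFiniteIntegral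

theorem gamma_mul_integral_charFun_rieszMeasure [Nontrivial E] (ha : 0 < a)
    (hi : Integrable (charFun μ) (rieszMeasure E (-(2 * a)))) :
    (Real.Gamma a : ℂ) * ∫ x, charFun μ x ∂rieszMeasure E (-(2 * a)) =
      ∫ r in Set.Ioi (0 : ℝ), ((r ^ (a - 1) * ((Real.pi / r) ^ (finrank ℝ E / 2 : ℝ) *
        ∫ z, Real.exp (-‖z‖ ^ 2 / (4 * r)) ∂μ) : ℝ) : ℂ) :=
  calc (Real.Gamma a : ℂ) * ∫ x, charFun μ x ∂rieszMeasure E (-(2 * a))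
      = ∫ x, (∫ r in Set.Ioi (0 : ℝ),
          charFun μ x * (r ^ (a - 1) * Real.exp (-r * ‖x‖ ^ 2) : ℝ)) := by
        rw [integral_rieszMeasure, ← integral_const_mul]
        refine integral_congr_ae ?_
        filter_upwards [Measure.ae_ne volume 0] with x hx
        rw [integral_const_mul, integral_complex_ofReal,
          integral_rpow_mul_exp_neg_mul_sq_norm ha hx, ofReal_mul]
        ring
    _ = ∫ r in Set.Ioi (0 : ℝ), ∫ x,
          charFun μ x * (r ^ (a - 1) * Real.exp (-r * ‖x‖ ^ 2) : ℝ) :=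
        integral_integral_swap (integrable_charFun_mul_gaussian_prod ha hi)
    _ = _ := setIntegral_congr_fun measurableSet_Ioi fun _ hr =>
        integral_charFun_mul_rpow_mul_gaussian μ a hr

theorem integral_charFun_rieszMeasure_ne_zero [Nontrivial E] (h0 : μ ≠ 0) (ha : 0 < a)
    (hi : Integrable (charFun μ) (rieszMeasure E (-(2 * a)))) :
    ∫ x, charFun μ x ∂rieszMeasure E (-(2 * a)) ≠ 0 := by
  set h : ℝ → ℝ := fun r => r ^ (a - 1) * ((Real.pi / r) ^ (finrank ℝ E / 2 : ℝ) *
    ∫ z, Real.exp (-‖z‖ ^ 2 / (4 * r)) ∂μ)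
  have hpos {r : ℝ} (hr : 0 < r) : 0 < h r := by
    have := integral_exp_neg_sq_norm_div_pos h0 hr
    positivity
  have hint : IntegrableOn h (Set.Ioi 0) := by
    have hcomplex : IntegrableOn (fun r => (h r : ℂ)) (Set.Ioi 0) :=
      (integrable_charFun_mul_gaussian_prod ha hi).integral_prod_right.congr <| by
        filter_upwards [ae_restrict_mem measurableSet_Ioi] with r hr
          using integral_charFun_mul_rpow_mul_gaussian μ a hr
    exact hcomplex.re
  have hsupport : Set.Ioi 0 ⊆ Function.support h := fun r hr => (hpos hr).ne'
  have hIoi : 0 < ∫ r in Set.Ioi 0, h r := by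
    rw [setIntegral_pos_iff_support_of_nonneg_ae
      (ae_restrict_of_forall_mem measurableSet_Ioi fun r hr => (hpos hr).le) hint,
      Set.inter_eq_right.mpr hsupport, Real.volume_Ioi]
    exact ENNReal.zero_lt_top
  intro hzero
  have hmain := gamma_mul_integral_charFun_rieszMeasure ha hi
  rw [hzero, mul_zero, integral_complex_ofReal, eq_comm, ofReal_eq_zero] at hmain
  exact hIoi.ne' hmain

end RieszPositivity

section OrthGroup

section

variable {E : Type*} [NormedAddCommGroup E] [NormedSpace ℝ E] [MeasurableSpace E] [BorelSpace E]
  [FiniteDimensional ℝ E] (μ : Measure E) [μ.IsAddHaarMeasure]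

theorem map_snd_homeomorphUnitSphereProd :
    (μ.comap Subtype.val).map (fun x => (homeomorphUnitSphereProd E x).2) =
      μ.toSphere Set.univ • Measure.volumeIoiPow (finrank ℝ E - 1) := by
  rw [← Measure.map_snd_prod, ← μ.measurePreserving_homeomorphUnitSphereProd.map_eq,
    Measure.map_map measurable_snd (Homeomorph.measurable _), Function.comp_def]

theorem lintegral_fun_norm [Nontrivial E] {f : ℝ → ℝ≥0∞} (hf : Measurable f) :
    ∫⁻ x, f ‖x‖ ∂μ = μ.toSphere Set.univ *
      ∫⁻ y in Set.Ioi (0 : ℝ), ENNReal.ofReal (y ^ (finrank ℝ E - 1)) * f y := by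
  have hpow : ∫⁻ y : Set.Ioi (0 : ℝ), f y ∂.volumeIoiPow (finrank ℝ E - 1) =
      ∫⁻ y in Set.Ioi (0 : ℝ), ENNReal.ofReal (y ^ (finrank ℝ E - 1)) * f y := by
    rw [← lintegral_subtype_comap measurableSet_Ioi, Measure.volumeIoiPow,
      lintegral_withDensity_eq_lintegral_mul _ (by fun_prop) (by fun_prop)]
    rfl
  have hsnd : Measurable fun x => (homeomorphUnitSphereProd E x).2 :=
    measurable_snd.comp (Homeomorph.measurable _)
  rw [← hpow, ← smul_eq_mul, ← lintegral_smul_measure, ← map_snd_homeomorphUnitSphereProd,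
    lintegral_map (by fun_prop) hsnd]
  simp_rw [homeomorphUnitSphereProd_apply_snd_coe]
  rw [lintegral_subtype_comap (measurableSet_singleton _).compl fun x => f ‖x‖,
    restrict_compl_singleton]

end

variable {n : ℕ}

instance (n : ℕ) : SecondCountableTopology (Eucl n →L[ℝ] Eucl n) :=
  have : ProperSpace (Eucl n →L[ℝ] Eucl n) := FiniteDimensional.proper ℝ _
  inferInstance

instance (n : ℕ) : (orthHaar n).IsHaarMeasure := by
  unfold orthHaar; infer_instance

instance (n : ℕ) : IsProbabilityMeasure (orthHaar n) :=
  ⟨by simpa [orthHaar] using Measure.haarMeasure_self (G := OrthGroup n) (K₀ := ⊤)⟩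

instance (n : ℕ) : (orthHaar n).IsMulRightInvariant := by
  refine ⟨fun g => ?_⟩
  have hprob : IsProbabilityMeasure ((orthHaar n).map (· * g)) :=
    Measure.isProbabilityMeasure_map (by fun_prop)
  exact Measure.isHaarMeasure_eq_of_isProbabilityMeasure _ _

theorem exists_orthGroup_apply_eq {x y : Eucl n} (h : ‖x‖ = ‖y‖) :
    ∃ g : OrthGroup n, (g : Eucl n →L[ℝ] Eucl n) x = y :=
  ⟨Unitary.linearIsometryEquiv.symm (Submodule.reflection (ℝ ∙ (x - y))ᗮ),
    Submodule.reflection_sub h⟩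

theorem norm_orthGroup_apply (g : OrthGroup n) (x : Eucl n) :
    ‖(g : Eucl n →L[ℝ] Eucl n) x‖ = ‖x‖ :=
  (Unitary.linearIsometryEquiv g).norm_map x

theorem measurable_orthGroup_apply (n : ℕ) :
    Measurable fun p : OrthGroup n × Eucl n => (p.1 : Eucl n →L[ℝ] Eucl n) p.2 :=
  ((continuous_subtype_val.comp continuous_fst).clm_apply continuous_snd).measurable

theorem measurable_orthGroup_apply_comp {X : Type*} [MeasurableSpace X] {f : X → Eucl n}
    (hf : Measurable f) :
    Measurable fun p : OrthGroup n × X => (p.1 : Eucl n →L[ℝ] Eucl n) (f p.2) :=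
  (measurable_orthGroup_apply n).comp (measurable_fst.prodMk (hf.comp measurable_snd))

theorem lintegral_comp_orthGroup_apply {f : Eucl n → ℝ≥0∞} (hf : Measurable f) (g : OrthGroup n) :
    ∫⁻ x, f ((g : Eucl n →L[ℝ] Eucl n) x) = ∫⁻ x, f x :=
  (Unitary.linearIsometryEquiv g).measurePreserving.lintegral_comp hf

theorem lintegral_orthGroup_apply_congr (f : Eucl n → ℝ≥0∞) {x y : Eucl n} (h : ‖x‖ = ‖y‖) :
    ∫⁻ g : OrthGroup n, f ((g : Eucl n →L[ℝ] Eucl n) x) ∂orthHaar n =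
      ∫⁻ g : OrthGroup n, f ((g : Eucl n →L[ℝ] Eucl n) y) ∂orthHaar n := by
  obtain ⟨k, rfl⟩ := exists_orthGroup_apply_eq h
  exact (lintegral_mul_right_eq_self
    (fun g : OrthGroup n => f ((g : Eucl n →L[ℝ] Eucl n) x)) k).symm

theorem exists_lintegral_orthGroup_apply_eq [Nontrivial (Eucl n)] {f : Eucl n → ℝ≥0∞}
    (hf : Measurable f) : ∃ F : ℝ → ℝ≥0∞, Measurable F ∧
      ∀ x, ∫⁻ g : OrthGroup n, f ((g : Eucl n →L[ℝ] Eucl n) x) ∂orthHaar n = F ‖x‖ := by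
  obtain ⟨e, he⟩ := exists_norm_eq (Eucl n) zero_le_one
  refine ⟨fun r => ∫⁻ g : OrthGroup n, f ((g : Eucl n →L[ℝ] Eucl n) (r • e)) ∂orthHaar n, ?_,
    fun x => lintegral_orthGroup_apply_congr f (by simp [norm_smul, he])⟩
  exact Measurable.lintegral_prod_right' (f := fun p : ℝ × OrthGroup n =>
    f ((p.2 : Eucl n →L[ℝ] Eucl n) (p.1 • e)))
    (hf.comp ((measurable_orthGroup_apply n).comp
      (measurable_snd.prodMk (measurable_fst.smul_const e))))

theorem lintegral_mul_lintegral_orthGroup_apply {f : Eucl n → ℝ≥0∞} (hf : Measurable f)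
    {w : ℝ → ℝ≥0∞} (hw : Measurable w) :
    ∫⁻ x, w ‖x‖ * ∫⁻ g : OrthGroup n, f ((g : Eucl n →L[ℝ] Eucl n) x) ∂orthHaar n =
      ∫⁻ x, w ‖x‖ * f x := by
  have hfm : Measurable fun p : Eucl n × OrthGroup n => f ((p.2 : Eucl n →L[ℝ] Eucl n) p.1) :=
    hf.comp ((measurable_orthGroup_apply n).comp measurable_swap)
  have hwf : Measurable fun x : Eucl n => w ‖x‖ * f x := (hw.comp measurable_norm).mul hf
  calc _ = ∫⁻ x, ∫⁻ g : OrthGroup n,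
        w ‖x‖ * f ((g : Eucl n →L[ℝ] Eucl n) x) ∂orthHaar n := by
        congr 1 with x
        exact (lintegral_const_mul _ (hfm.comp measurable_prodMk_left)).symm
    _ = ∫⁻ g : OrthGroup n, (∫⁻ x, w ‖x‖ * f ((g : Eucl n →L[ℝ] Eucl n) x)) ∂orthHaar n :=
        lintegral_lintegral_swap ((hw.comp measurable_fst.norm).mul hfm).aemeasurable
    _ = ∫⁻ _ : OrthGroup n, (∫⁻ x, w ‖x‖ * f x) ∂orthHaar n := by
        congr 1 with g
        simpa only [norm_orthGroup_apply] using
          lintegral_comp_orthGroup_apply hwf g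
    _ = _ := by rw [lintegral_const, measure_univ, mul_one]

end OrthGroup

section RandomPlane

variable {n : ℕ} {F : Type*} [NormedAddCommGroup F] [InnerProductSpace ℝ F]
  [FiniteDimensional ℝ F] [MeasurableSpace F] [BorelSpace F]

theorem lintegral_rieszMeasure_fun_norm [Nontrivial F] {d : ℕ} (hd : 0 < d) (hdF : d ≤ finrank ℝ F)
    {Φ : ℝ → ℝ≥0∞} (hΦ : Measurable Φ) :
    ∫⁻ x, Φ ‖x‖ ∂rieszMeasure F (d - finrank ℝ F) = (volume : Measure F).toSphere Set.univ *
      ∫⁻ y in Set.Ioi (0 : ℝ), ENNReal.ofReal (y ^ (d - 1)) * Φ y := by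
  rw [lintegral_rieszMeasure _ (by fun_prop)]
  simp_rw [← ofReal_norm]
  rw [lintegral_fun_norm _
    (f := fun y => Φ y * ENNReal.ofReal y ^ ((d : ℝ) - finrank ℝ F)) (by fun_prop)]
  congr 1
  refine setLIntegral_congr_fun measurableSet_Ioi fun y (hy : 0 < y) => ?_
  have hpow : y ^ (finrank ℝ F - 1) * y ^ ((d : ℝ) - finrank ℝ F) = y ^ (d - 1) := by
    rw [← Real.rpow_natCast, ← Real.rpow_natCast, ← Real.rpow_add hy, Nat.cast_sub hd,
      Nat.cast_sub (hd.trans_le hdF)]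
    ring_nf
  rw [ENNReal.ofReal_rpow_of_pos hy, mul_left_comm, ← ENNReal.ofReal_mul (by positivity), hpow,
    mul_comm]

/-- The distribution of the point `g (ι u)`, where `g` is Haar distributed in `O(n)` and `u` is
Lebesgue distributed. For an isometric `ι` it is the mean over random `g` of Lebesgue measure on
the plane `g (range ι)`. -/
def randomPlaneMeasure (ι : F →ₗᵢ[ℝ] Eucl n) : Measure (Eucl n) :=
  ((orthHaar n).prod volume).map fun p => (p.1 : Eucl n →L[ℝ] Eucl n) (ι p.2)

theorem exists_randomPlaneMeasure_eq [Nontrivial F] (ι : F →ₗᵢ[ℝ] Eucl n) :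
    ∃ c : ℝ≥0∞, c ≠ 0 ∧ c ≠ ⊤ ∧
      randomPlaneMeasure ι = c • rieszMeasure (Eucl n) (finrank ℝ F - n) := by
  have hnontrivial : Nontrivial (Eucl n) := ι.injective.nontrivial
  have hF : 0 < finrank ℝ F := finrank_pos
  have hFn : finrank ℝ F ≤ finrank ℝ (Eucl n) := LinearMap.finrank_le_finrank_of_injective
    (f := ι.toLinearMap) ι.injective
  set cF := (volume : Measure F).toSphere Set.univ
  set cn := (volume : Measure (Eucl n)).toSphere Set.univ
  have hcF : cF ≠ 0 := Measure.measure_univ_ne_zero.mpr (Measure.toSphere_ne_zero _)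
  have hcn : cn ≠ 0 := Measure.measure_univ_ne_zero.mpr (Measure.toSphere_ne_zero _)
  refine ⟨cF / cn, ENNReal.div_ne_zero.mpr ⟨hcF, measure_ne_top _ _⟩,
    ENNReal.div_ne_top (measure_ne_top _ _) hcn, Measure.ext_of_lintegral _ fun f hf => ?_⟩
  obtain ⟨Φ, hΦ, hfΦ⟩ := exists_lintegral_orthGroup_apply_eq hf
  have hplane : ∫⁻ x, f x ∂randomPlaneMeasure ι =
      cF * ∫⁻ y in Set.Ioi (0 : ℝ), ENNReal.ofReal (y ^ (finrank ℝ F - 1)) * Φ y := by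
    have hmeas := measurable_orthGroup_apply_comp ι.continuous.measurable
    have hfm : Measurable fun p : OrthGroup n × F => f ((p.1 : Eucl n →L[ℝ] Eucl n) (ι p.2)) :=
      hf.comp hmeas
    rw [randomPlaneMeasure, lintegral_map hf hmeas, lintegral_prod_symm' _ hfm]
    simp_rw [hfΦ, ι.norm_map]
    exact lintegral_fun_norm _ hΦ
  have hriesz : ∫⁻ x, f x ∂rieszMeasure (Eucl n) (finrank ℝ F - n) =
      cn * ∫⁻ y in Set.Ioi (0 : ℝ), ENNReal.ofReal (y ^ (finrank ℝ F - 1)) * Φ y := by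
    have hw : Measurable fun y : ℝ => ENNReal.ofReal y ^ ((finrank ℝ F : ℝ) - n) := by fun_prop
    have hmean := lintegral_mul_lintegral_orthGroup_apply hf hw
    have hradial := lintegral_rieszMeasure_fun_norm hF hFn hΦ
    rw [finrank_euclideanSpace_fin, lintegral_rieszMeasure _ (by fun_prop)] at hradial
    rw [lintegral_rieszMeasure _ hf, ← hradial]
    simpa only [hfΦ, ofReal_norm, mul_comm] using hmean.symm
  rw [hplane, lintegral_smul_measure, hriesz, smul_eq_mul, ← mul_assoc,
    ENNReal.div_mul_cancel hcn (measure_ne_top _ _)]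

theorem integrable_orthGroup_apply_prod [Nontrivial F] (ι : F →ₗᵢ[ℝ] Eucl n) {f : Eucl n → ℂ}
    (hi : Integrable f (rieszMeasure (Eucl n) (finrank ℝ F - n))) (hf : Measurable f) :
    Integrable (fun p : OrthGroup n × F => f ((p.1 : Eucl n →L[ℝ] Eucl n) (ι p.2)))
      ((orthHaar n).prod volume) := by
  obtain ⟨c, -, hc, hplane⟩ := exists_randomPlaneMeasure_eq ι
  have hi' := hi.smul_measure hc
  rw [← hplane, randomPlaneMeasure] at hi'
  exact (integrable_map_measure hf.aestronglyMeasurable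
    (measurable_orthGroup_apply_comp ι.continuous.measurable).aemeasurable).mp hi'

theorem ae_integrable_orthGroup_apply [Nontrivial F] (ι : F →ₗᵢ[ℝ] Eucl n) {f : Eucl n → ℂ}
    (hi : Integrable f (rieszMeasure (Eucl n) (finrank ℝ F - n))) (hf : Measurable f) :
    ∀ᵐ g : OrthGroup n ∂orthHaar n,
      Integrable fun u => f ((g : Eucl n →L[ℝ] Eucl n) (ι u)) :=
  (integrable_orthGroup_apply_prod ι hi hf).prod_right_ae

theorem frequently_integral_orthGroup_apply_ne_zero [Nontrivial F] (ι : F →ₗᵢ[ℝ] Eucl n)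
    {f : Eucl n → ℂ} (hi : Integrable f (rieszMeasure (Eucl n) (finrank ℝ F - n)))
    (hf : Measurable f) (h0 : ∫ x, f x ∂rieszMeasure (Eucl n) (finrank ℝ F - n) ≠ 0) :
    ∃ᵐ g : OrthGroup n ∂orthHaar n, ∫ u, f ((g : Eucl n →L[ℝ] Eucl n) (ι u)) ≠ 0 := by
  obtain ⟨c, hc0, hc, hplane⟩ := exists_randomPlaneMeasure_eq ι
  have hne : ∫ x, f x ∂randomPlaneMeasure ι ≠ 0 := by
    rw [hplane, integral_smul_measure]
    exact smul_ne_zero (ENNReal.toReal_ne_zero.mpr ⟨hc0, hc⟩) h0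
  rw [randomPlaneMeasure, integral_map
    (measurable_orthGroup_apply_comp ι.continuous.measurable).aemeasurable hf.aestronglyMeasurable,
    integral_prod _ (integrable_orthGroup_apply_prod ι hi hf)] at hne
  contrapose! hne with hzero
  exact integral_eq_zero_of_ae hzero

theorem lintegral_rieszMeasure_one_add_norm_lt_top [Nontrivial F] (ι : F →ₗᵢ[ℝ] Eucl n) {p : ℝ}
    (hp : finrank ℝ F < p) :
    ∫⁻ x, ENNReal.ofReal ((1 + ‖x‖) ^ (-p)) ∂rieszMeasure (Eucl n) (finrank ℝ F - n) < ⊤ := by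
  obtain ⟨c, hc0, -, hplane⟩ := exists_randomPlaneMeasure_eq ι
  have hΦ : Measurable fun x : Eucl n => ENNReal.ofReal ((1 + ‖x‖) ^ (-p)) := by fun_prop
  have hmeas := measurable_orthGroup_apply_comp ι.continuous.measurable
  have hmean : ∫⁻ x, ENNReal.ofReal ((1 + ‖x‖) ^ (-p)) ∂randomPlaneMeasure ι =
      ∫⁻ u : F, ENNReal.ofReal ((1 + ‖u‖) ^ (-p)) := by
    rw [randomPlaneMeasure, lintegral_map hΦ hmeas]
    simp_rw [norm_orthGroup_apply, ι.norm_map]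
    rw [lintegral_prod _ (by fun_prop)]
    dsimp only
    rw [lintegral_const, measure_univ, mul_one]
  have hlt := hmean.trans_lt (integrable_one_add_norm hp).lintegral_lt_top
  rw [hplane, lintegral_smul_measure] at hlt
  exact ENNReal.lt_top_of_mul_ne_top_right hlt.ne hc0

end RandomPlane

section Integrability

theorem le_one_add_rpow_add_sq_mul_rpow {a C t p : ℝ} (ha : 0 ≤ a) (haC : a ≤ C) (ht : 0 ≤ t)
    (hp : 0 ≤ p) : a ≤ (1 + C) * 2 ^ p * (1 + t) ^ (-p) + a ^ 2 * t ^ p := by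
  have hC : 0 ≤ C := ha.trans haC
  rw [Real.rpow_neg (by positivity), ← div_eq_mul_inv]
  rcases le_total t 1 with ht1 | ht1
  · have hpow : (1 + t) ^ p ≤ 2 ^ p := by gcongr; linarith
    calc a ≤ 1 + C := by linarith
      _ ≤ (1 + C) * 2 ^ p / (1 + t) ^ p := by rw [le_div_iff₀ (by positivity)]; gcongr
      _ ≤ _ := le_add_of_nonneg_right (by positivity)
  · have hpow : (1 + t) ^ p ≤ 2 ^ p * t ^ p := by
      rw [← Real.mul_rpow two_pos.le ht]
      gcongr
      linarith
    have htp : 0 < t ^ p := by positivity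
    -- AM-GM for `(t ^ p)⁻¹` and `a ^ 2 * t ^ p`, without the constant `1 / 2`
    calc a ≤ (t ^ p)⁻¹ + a ^ 2 * t ^ p := by
          have hsq : 0 ≤ (a * t ^ p - 1) ^ 2 * (t ^ p)⁻¹ := by positivity
          have hexpand : (a * t ^ p - 1) ^ 2 * (t ^ p)⁻¹ =
            (t ^ p)⁻¹ + a ^ 2 * t ^ p - 2 * a := by field_simp; ring
          linarith
      _ ≤ 2 ^ p / (1 + t) ^ p + a ^ 2 * t ^ p := by
          gcongr
          rwa [le_div_iff₀ (by positivity), inv_mul_le_iff₀ htp, mul_comm]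
      _ ≤ _ := by gcongr; exact le_mul_of_one_le_left (by positivity) (by linarith)

theorem integrable_of_lintegral_enorm_sq_mul_rpow_lt_top {E G : Type*} [NormedAddCommGroup E]
    [MeasurableSpace E] [BorelSpace E] [NormedAddCommGroup G] {ρ : Measure E} {f : E → G}
    (hf : AEStronglyMeasurable f ρ) {C p : ℝ} (hC : ∀ x, ‖f x‖ ≤ C) (hp : 0 ≤ p)
    (hdecay : ∫⁻ x, ENNReal.ofReal ((1 + ‖x‖) ^ (-p)) ∂ρ < ⊤)
    (hsq : ∫⁻ x, ‖f x‖ₑ ^ 2 * ‖x‖ₑ ^ p ∂ρ < ⊤) : Integrable f ρ := by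
  refine ⟨hf, ?_⟩
  have hle (x : E) : ‖f x‖ₑ ≤ ENNReal.ofReal ((1 + C) * 2 ^ p) * ENNReal.ofReal ((1 + ‖x‖) ^ (-p)) +
      ‖f x‖ₑ ^ 2 * ‖x‖ₑ ^ p := by
    have hC0 : 0 ≤ C := (norm_nonneg (f x)).trans (hC x)
    rw [← ofReal_norm, ← ofReal_norm, ENNReal.ofReal_rpow_of_nonneg (norm_nonneg _) hp,
      ← ENNReal.ofReal_pow (norm_nonneg _), ← ENNReal.ofReal_mul (by positivity),
      ← ENNReal.ofReal_mul (by positivity), ← ENNReal.ofReal_add (by positivity) (by positivity)]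
    exact ENNReal.ofReal_le_ofReal
      (le_one_add_rpow_add_sq_mul_rpow (norm_nonneg _) (hC x) (norm_nonneg _) hp)
  refine (lintegral_mono hle).trans_lt ?_
  rw [lintegral_add_left (by fun_prop), lintegral_const_mul' _ _ ENNReal.ofReal_ne_top]
  exact ENNReal.add_lt_top.mpr ⟨ENNReal.mul_lt_top ENNReal.ofReal_lt_top hdecay, hsq⟩

theorem mul_le_sq_add_sq (a b : ℝ≥0∞) : a * b ≤ a ^ 2 + b ^ 2 := by
  rcases le_total a b with h | h
  · calc a * b ≤ b ^ 2 := by rw [sq]; gcongr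
      _ ≤ _ := le_add_self
  · calc a * b ≤ a ^ 2 := by rw [sq]; gcongr
      _ ≤ _ := le_self_add

variable {E : Type*} [NormedAddCommGroup E] [InnerProductSpace ℝ E] [FiniteDimensional ℝ E]
  [MeasurableSpace E] [BorelSpace E] {μ ν : Measure E} [IsFiniteMeasure μ] [IsFiniteMeasure ν]

theorem enorm_rpow_add_ae_eq [Nontrivial E] (p q : ℝ) :
    ∀ᵐ x : E, ‖x‖ₑ ^ (p + q) = ‖x‖ₑ ^ p * ‖x‖ₑ ^ q := by
  filter_upwards [Measure.ae_ne volume 0] with x hx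
  exact ENNReal.rpow_add _ _ (by simpa using hx) (by simp)

theorem integrable_charFun_diffMeasure_rieszMeasure [Nontrivial E] {p q r : ℝ}
    (hpq : p + q = 2 * r) (hμ : ∫⁻ x, ‖charFun μ x‖ₑ ^ 2 * ‖x‖ₑ ^ p < ⊤)
    (hν : ∫⁻ x, ‖charFun ν x‖ₑ ^ 2 * ‖x‖ₑ ^ q < ⊤) :
    Integrable (charFun (diffMeasure μ ν)) (rieszMeasure E r) := by
  refine ⟨measurable_charFun.aestronglyMeasurable, ?_⟩
  rw [hasFiniteIntegral_iff_enorm, lintegral_rieszMeasure _ (by fun_prop)]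
  calc ∫⁻ x, ‖charFun (diffMeasure μ ν) x‖ₑ * ‖x‖ₑ ^ r
      ≤ ∫⁻ x, (‖charFun μ x‖ₑ ^ 2 * ‖x‖ₑ ^ p + ‖charFun ν x‖ₑ ^ 2 * ‖x‖ₑ ^ q) := by
        refine lintegral_mono_ae ?_
        filter_upwards [enorm_rpow_add_ae_eq (p / 2) (q / 2)] with x hx
        have hhalf (p : ℝ) : (‖x‖ₑ ^ (p / 2)) ^ 2 = ‖x‖ₑ ^ p := by
          rw [← ENNReal.rpow_mul_natCast, Nat.cast_two, div_mul_cancel₀ p two_ne_zero]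
        rw [show p / 2 + q / 2 = r by linarith] at hx
        rw [charFun_diffMeasure, enorm_mul, RCLike.enorm_conj, hx, mul_mul_mul_comm, ← hhalf p,
          ← hhalf q, ← mul_pow, ← mul_pow]
        exact mul_le_sq_add_sq _ _
    _ < ⊤ := by
        rw [lintegral_add_left (by fun_prop)]
        exact ENNReal.add_lt_top.mpr ⟨hμ, hν⟩

theorem integrable_charFun_diffMeasure {ρ : Measure E} (hμ : Integrable (charFun μ) ρ) :
    Integrable (charFun (diffMeasure μ ν)) ρ := by
  simp_rw [funext (charFun_diffMeasure (μ := μ) (ν := ν))]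
  refine hμ.mul_bdd (c := ν.real Set.univ) (by fun_prop) (.of_forall fun x => ?_)
  simpa using norm_charFun_le x

end Integrability

section Planes

section

variable {E F : Type*} [NormedAddCommGroup E] [InnerProductSpace ℝ E] [NormedAddCommGroup F]
  [InnerProductSpace ℝ F] {V : Submodule ℝ E} [V.HasOrthogonalProjection]

/-- The orthogonal projection onto `V`, read in the coordinates of `V` given by `e`. -/
def projCoord (e : F ≃ₗᵢ[ℝ] V) : E →L[ℝ] F :=
  (e.symm : V →L[ℝ] F) ∘L V.orthogonalProjectionOnto

theorem inner_projCoord_left (e : F ≃ₗᵢ[ℝ] V) (x : E) (u : F) :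
    ⟪projCoord e x, u⟫ = ⟪x, (e u : E)⟫ :=
  calc ⟪projCoord e x, u⟫ = ⟪V.orthogonalProjectionOnto x, e u⟫ := e.symm.inner_map_eq_flip _ _
    _ = ⟪x, (e u : E)⟫ := Submodule.inner_orthogonalProjectionOnto_eq_of_mem_right _ _

theorem charFun_map_projCoord [MeasurableSpace E] [BorelSpace E] [MeasurableSpace F] [BorelSpace F]
    [SecondCountableTopology F] (μ : Measure E) (e : F ≃ₗᵢ[ℝ] V) (u : F) :
    charFun (μ.map (projCoord e)) u = charFun μ (e u : E) := by
  rw [charFun_apply, charFun_apply, integral_map (by fun_prop)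
    (Continuous.aestronglyMeasurable (by fun_prop))]
  simp_rw [inner_projCoord_left]

end

variable {n m : ℕ} {V : Grassmannian n m} {μ ν : Measure (Eucl n)}

theorem projSet_eq_image_projCoord (e : Eucl m ≃ₗᵢ[ℝ] V.1) (A : Set (Eucl n)) :
    projSet V A = e '' (projCoord e '' A) := by
  rw [Set.image_image]
  exact Set.image_congr fun x _ => (e.apply_symm_apply _).symm

theorem image_support_map_projCoord_subset (e : Eucl m ≃ₗᵢ[ℝ] V.1) (hμ : IsCompact μ.support) :
    e '' (μ.map (projCoord e)).support ⊆ projSet V μ.support := by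
  rw [projSet_eq_image_projCoord e]
  exact Set.image_mono (support_map_subset (projCoord e).continuous hμ)

theorem image_support_inter_subset_projSet (e : Eucl m ≃ₗᵢ[ℝ] V.1) (hμ : IsCompact μ.support)
    (hν : IsCompact ν.support) :
    e '' ((μ.map (projCoord e)).support ∩ (ν.map (projCoord e)).support) ⊆
      projSet V μ.support ∩ projSet V ν.support :=
  (Set.image_inter_subset _ _ _).trans (Set.inter_subset_inter
    (image_support_map_projCoord_subset e hμ) (image_support_map_projCoord_subset e hν))

theorem isCompact_support_map_projCoord (e : Eucl m ≃ₗᵢ[ℝ] V.1) (hμ : IsCompact μ.support) :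
    IsCompact (μ.map (projCoord e)).support :=
  (hμ.image (projCoord e).continuous).of_isClosed_subset Measure.isClosed_support
    (support_map_subset (projCoord e).continuous hμ)

variable [IsFiniteMeasure μ] [IsFiniteMeasure ν]

theorem charFun_diffMeasure_map_projCoord (e : Eucl m ≃ₗᵢ[ℝ] V.1) :
    charFun (diffMeasure (μ.map (projCoord e)) (ν.map (projCoord e))) =
      fun u => charFun (diffMeasure μ ν) (e u : Eucl n) := by
  ext u
  simp only [charFun_diffMeasure, charFun_map_projCoord]

theorem projSet_inter_nonempty_of_integral_charFun_ne_zero (e : Eucl m ≃ₗᵢ[ℝ] V.1)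
    (hμ : IsCompact μ.support) (hν : IsCompact ν.support)
    (hi : Integrable fun u => charFun (diffMeasure μ ν) (e u : Eucl n))
    (h0 : ∫ u, charFun (diffMeasure μ ν) (e u : Eucl n) ≠ 0) :
    (projSet V μ.support ∩ projSet V ν.support).Nonempty := by
  rw [← charFun_diffMeasure_map_projCoord] at hi h0
  exact ((support_inter_nonempty_of_integral_charFun_ne_zero (isCompact_support_map_projCoord e hμ)
    (isCompact_support_map_projCoord e hν) hi h0).image e).mono
    (image_support_inter_subset_projSet e hμ hν)

theorem interior_projSet_inter_nonempty_of_integral_charFun_ne_zero (e : Eucl m ≃ₗᵢ[ℝ] V.1)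
    (hμ : IsCompact μ.support) (hν : IsCompact ν.support)
    (hiμ : Integrable fun u => charFun μ (e u : Eucl n))
    (hiν : Integrable fun u => charFun ν (e u : Eucl n))
    (h0 : ∫ u, charFun (diffMeasure μ ν) (e u : Eucl n) ≠ 0) :
    (interior (projSet V μ.support ∩ projSet V ν.support)).Nonempty := by
  simp_rw [← charFun_map_projCoord] at hiμ hiν
  rw [← charFun_diffMeasure_map_projCoord] at h0
  have hinterior := interior_support_inter_nonempty_of_integral_charFun_ne_zero
    (isCompact_support_map_projCoord e hν) hiμ hiν h0
  refine (hinterior.image e).mono ?_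
  exact (e.toHomeomorph.image_interior _).subset.trans
    (interior_mono (image_support_inter_subset_projSet e hμ hν))

theorem projSet_eq_univ {V : Grassmannian n 0} {A : Set (Eucl n)} (hA : A.Nonempty) :
    projSet V A = Set.univ :=
  have : Subsingleton V.1 := finrank_zero_iff.mp V.2
  (hA.image _).eq_univ

end Planes

section Grassmannian

variable {n m : ℕ}

theorem IsAdmissible.isFiniteMeasure {μ : Measure (Eucl n)} (h : IsAdmissible Set.univ μ) :
    IsFiniteMeasure μ := ⟨h.lt_top⟩

theorem IsAdmissible.ne_zero {A : Set (Eucl n)} {μ : Measure (Eucl n)} (h : IsAdmissible A μ) :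
    μ ≠ 0 := by
  rintro rfl
  exact h.pos.ne rfl

theorem grassMeasure_pos_of_frequently (h : m ≤ n) {A : Set (Grassmannian n m)}
    (hA : ∃ᵐ g ∂orthHaar n, rotate g (coordPlane h) ∈ A) : 0 < grassMeasure h A := by
  rw [frequently_ae_iff] at hA
  exact (pos_iff_ne_zero.mpr hA).trans_le
    (Measure.le_map_apply (continuous_rotate _).measurable.aemeasurable A)

/-- Orthonormal coordinates on an `m`-plane. -/
def planeParam (V : Grassmannian n m) : Eucl m ≃ₗᵢ[ℝ] V.1 :=
  ((stdOrthonormalBasis ℝ V.1).reindex (finCongr V.2)).repr.symm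

/-- The coordinates of `g V` obtained by rotating those of `V`, so that integrals over `g V` become
integrals of `u ↦ f (g (planeParam V u))` over `ℝᵐ`. -/
def rotatedParam (g : OrthGroup n) (V : Grassmannian n m) : Eucl m ≃ₗᵢ[ℝ] (rotate g V).1 :=
  (planeParam V).trans ((Unitary.linearIsometryEquiv g).submoduleMap V.1)

/-- The isometric embedding of `ℝᵐ` onto an `m`-plane. -/
def planeEmbedding (V : Grassmannian n m) : Eucl m →ₗᵢ[ℝ] Eucl n :=
  V.1.subtypeₗᵢ.comp (planeParam V).toLinearIsometry

theorem coe_rotatedParam (g : OrthGroup n) (V : Grassmannian n m) (u : Eucl m) :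
    (rotatedParam g V u : Eucl n) = (g : Eucl n →L[ℝ] Eucl n) (planeEmbedding V u) :=
  rfl

theorem nontrivial_eucl_of_le [NeZero m] (hmn : m ≤ n) : Nontrivial (Eucl n) :=
  (planeEmbedding (coordPlane hmn)).injective.nontrivial

theorem grassMeasure_interior_projSet_inter_nonempty_zero {μ ν : Measure (Eucl n)} (hμ : μ ≠ 0)
    (hν : ν ≠ 0) :
    grassMeasure n.zero_le
      {V | (interior (projSet V μ.support ∩ projSet V ν.support)).Nonempty} = 1 := by
  simp [projSet_eq_univ (Measure.nonempty_support hμ),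
    projSet_eq_univ (Measure.nonempty_support hν)]

end Grassmannian

section Intersection

variable {n m : ℕ} {μ ν : Measure (Eucl n)} [IsFiniteMeasure μ] [IsFiniteMeasure ν]

theorem integrable_charFun_rieszMeasure [NeZero m] (hmn : m ≤ n) {s : ℝ} (hs : 2 * m < s)
    (hE : energy s μ < ⊤) : Integrable (charFun μ) (rieszMeasure (Eucl n) (m - n)) := by
  have hnontrivial : Nontrivial (Eucl n) := nontrivial_eucl_of_le hmn
  have : (0 : ℝ) ≤ m := m.cast_nonneg
  have hdecay := lintegral_rieszMeasure_one_add_norm_lt_top (planeEmbedding (coordPlane hmn))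
    (p := s - m) (by rw [finrank_euclideanSpace_fin]; linarith)
  rw [finrank_euclideanSpace_fin] at hdecay
  refine integrable_of_lintegral_enorm_sq_mul_rpow_lt_top (C := μ.real Set.univ)
    measurable_charFun.aestronglyMeasurable (fun x => by simpa using norm_charFun_le x)
    (by linarith) hdecay ?_
  rw [lintegral_rieszMeasure _ (by fun_prop)]
  refine (lintegral_congr_ae ?_).trans_lt
    (lintegral_enorm_charFun_sq_mul_rpow_lt_top (by linarith : 0 < s) hE)
  filter_upwards [enorm_rpow_add_ae_eq (s - m) (m - n)] with x hx
  rw [mul_assoc, ← hx, sub_add_sub_cancel]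

theorem frequently_integral_charFun_diffMeasure_ne_zero [NeZero m] (hmn : m < n) (hμ : μ ≠ 0)
    (hν : ν ≠ 0) (hi : Integrable (charFun (diffMeasure μ ν)) (rieszMeasure (Eucl n) (m - n))) :
    ∃ᵐ g ∂orthHaar n, ∫ u, charFun (diffMeasure μ ν)
      (rotatedParam g (coordPlane hmn.le) u : Eucl n) ≠ 0 := by
  have hnontrivial : Nontrivial (Eucl n) := nontrivial_eucl_of_le hmn.le
  have hmn' : (m : ℝ) < n := by exact_mod_cast hmn
  have hexp : (m : ℝ) - n = -(2 * ((n - m) / 2)) := by ring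
  have h0 := integral_charFun_rieszMeasure_ne_zero (diffMeasure_ne_zero hμ hν)
    (by linarith : 0 < ((n : ℝ) - m) / 2) (hexp ▸ hi)
  rw [← hexp] at h0
  simp_rw [coe_rotatedParam]
  exact frequently_integral_orthGroup_apply_ne_zero _ (by rwa [finrank_euclideanSpace_fin])
    measurable_charFun (by rwa [finrank_euclideanSpace_fin])

theorem ae_integrable_charFun_rotatedParam [NeZero m] (hmn : m ≤ n)
    (hi : Integrable (charFun μ) (rieszMeasure (Eucl n) (m - n))) :
    ∀ᵐ g ∂orthHaar n,
      Integrable fun u => charFun μ (rotatedParam g (coordPlane hmn) u : Eucl n) := by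
  simp_rw [coe_rotatedParam]
  exact ae_integrable_orthGroup_apply _ (by rwa [finrank_euclideanSpace_fin]) measurable_charFun

theorem grassMeasure_projSet_inter_nonempty_pos [NeZero m] (hmn : m < n) (hμ : μ ≠ 0) (hν : ν ≠ 0)
    (hcμ : IsCompact μ.support) (hcν : IsCompact ν.support) {s t : ℝ} (hs : 0 < s) (ht : 0 < t)
    (hst : s + t = 2 * m) (hEμ : energy s μ < ⊤) (hEν : energy t ν < ⊤) :
    0 < grassMeasure hmn.le {V | (projSet V μ.support ∩ projSet V ν.support).Nonempty} := by
  have hnontrivial : Nontrivial (Eucl n) := nontrivial_eucl_of_le hmn.le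
  have hi : Integrable (charFun (diffMeasure μ ν)) (rieszMeasure (Eucl n) (m - n)) :=
    integrable_charFun_diffMeasure_rieszMeasure (by linarith)
      (lintegral_enorm_charFun_sq_mul_rpow_lt_top hs hEμ)
      (lintegral_enorm_charFun_sq_mul_rpow_lt_top ht hEν)
  refine grassMeasure_pos_of_frequently hmn.le
    (((frequently_integral_charFun_diffMeasure_ne_zero hmn hμ hν hi).and_eventually
      (ae_integrable_charFun_rotatedParam hmn.le hi)).mono fun g ⟨h0, hig⟩ => ?_)
  exact projSet_inter_nonempty_of_integral_charFun_ne_zero (rotatedParam g _) hcμ hcν hig h0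

theorem grassMeasure_interior_projSet_inter_nonempty_pos [NeZero m] (hmn : m < n) (hμ : μ ≠ 0)
    (hν : ν ≠ 0) (hcμ : IsCompact μ.support) (hcν : IsCompact ν.support) {s t : ℝ}
    (hs : 2 * m < s) (ht : 2 * m < t) (hEμ : energy s μ < ⊤) (hEν : energy t ν < ⊤) :
    0 < grassMeasure hmn.le
      {V | (interior (projSet V μ.support ∩ projSet V ν.support)).Nonempty} := by
  have hiμ := integrable_charFun_rieszMeasure hmn.le hs hEμ
  have hiν := integrable_charFun_rieszMeasure hmn.le ht hEν
  have hi : Integrable (charFun (diffMeasure μ ν)) _ := integrable_charFun_diffMeasure hiμ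
  refine grassMeasure_pos_of_frequently hmn.le
    (((frequently_integral_charFun_diffMeasure_ne_zero hmn hμ hν hi).and_eventually
      ((ae_integrable_charFun_rotatedParam hmn.le hiμ).and
        (ae_integrable_charFun_rotatedParam hmn.le hiν))).mono fun g ⟨h0, higμ, higν⟩ => ?_)
  exact interior_projSet_inter_nonempty_of_integral_charFun_ne_zero (rotatedParam g _) hcμ hcν
    higμ higν h0

end Intersection

end ProjIntersect

end

theorem mainTheorem6 (n m : ℕ) (hmn : m ≤ n) (μ ν : MeasureTheory.Measure (ProjIntersect.Eucl n))
    (hμ : ProjIntersect.IsAdmissible Set.univ μ) (hν : ProjIntersect.IsAdmissible Set.univ ν) :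
    (∀ s t : ℝ, 0 < s → 0 < t → s + t = 2 * (m : ℝ) → ProjIntersect.energy s μ < ⊤ → ProjIntersect.energy t ν < ⊤ →
      0 < ProjIntersect.grassMeasure hmn
        {V | (ProjIntersect.projSet V μ.support ∩ ProjIntersect.projSet V ν.support).Nonempty}) ∧
    (∀ s t : ℝ, 2 * (m : ℝ) < s → 2 * (m : ℝ) < t → ProjIntersect.energy s μ < ⊤ → ProjIntersect.energy t ν < ⊤ →
      0 < ProjIntersect.grassMeasure hmn
        {V | (interior (ProjIntersect.projSet V μ.support ∩ ProjIntersect.projSet V ν.support)).Nonempty}) := by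
  have := hμ.isFiniteMeasure
  have := hν.isFiniteMeasure
  refine ⟨fun s t hs ht hst hEμ hEν => ?_, fun s t hs ht hEμ hEν => ?_⟩
  · have hsn := ProjIntersect.lt_of_energy_lt_top hμ.ne_zero hs hEμ
    have htn := ProjIntersect.lt_of_energy_lt_top hν.ne_zero ht hEν
    have hm : 0 < m := by rify; linarith
    have hmn' : m < n := by rify; linarith
    have : NeZero m := ⟨hm.ne'⟩
    exact ProjIntersect.grassMeasure_projSet_inter_nonempty_pos hmn' hμ.ne_zero hν.ne_zero
      hμ.isCompact_support hν.isCompact_support hs ht hst hEμ hEν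
  · rcases m.eq_zero_or_pos with rfl | hm
    · rw [ProjIntersect.grassMeasure_interior_projSet_inter_nonempty_zero hμ.ne_zero hν.ne_zero]
      exact one_pos
    · have hm' : (0 : ℝ) < m := by exact_mod_cast hm
      have hsn := ProjIntersect.lt_of_energy_lt_top hμ.ne_zero (by linarith) hEμ
      have hmn' : m < n := by rify; linarith
      have : NeZero m := ⟨hm.ne'⟩
      exact ProjIntersect.grassMeasure_interior_projSet_inter_nonempty_pos hmn' hμ.ne_zero
        hν.ne_zero hμ.isCompact_support hν.isCompact_support hs ht hEμ hEν
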